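/- Let $G$ be a finitely generated group and let $S$ be a finite generating subset of $G$, with associated word metric $d$ (word length with respect to $S\cup S^{-1}$). For a subset $Y\subseteq G$, the pair $(G,Y)$ has relative Property (T) if for every orthogonal representation $\pi$ of $G$ on a real Hilbert space and every sequence $(v_n)$ of unit vectors with $\|\pi(g)v_n-v_n\|\to 0$ for every $g\in G$, one has $\sup_{y\in Y}\|\pi(y)v_n-v_n\|\to 0$. The group $G$ has the Haagerup property if it admits a metrically proper affine isometric action $\sigma(g)v=\pi(g)v+b(g)$ on a real Hilbert space, that is, one for which $\{g\in G:\|b(g)\|\le R\}$ is finite for every $R$ (equivalently, $b$ is a coarse embedding). A finite quotient of $G$ is a finite group $Q$ with a surjective homomorphism $G\to Q$, denoted $g\mapsto\bar g$. (i) Suppose that $Y\subseteq G$ is an infinite subset such that $(G,Y)$ has relative Property (T). Then there exists $C>0$ such that for every finite quotient $Q$ of $G$, every function $f$ from $Q$ to a (real or complex) Hilbert space, and every $y\in Y$, $$\sum_{g\in Q}\|f(g\bar y)-f(g)\|^2\le C\sum_{g\in Q,\ s\in S}\|f(g\bar s)-f(g)\|^2 .$$ (ii) Suppose only that $G$ does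 not have the Haagerup property. Then there exist $C>0$ and a sequence of probability measures $(\mu_n)_{n\in\mathbb N}$ on $G$ whose supports $W_n$ are finite and satisfy $d(e,W_n)\to\infty$, such that for every $n\in\mathbb N$, every finite quotient $Q$ of $G$, and every function $f$ from $Q$ to a (real or complex) Hilbert space, $$\sum_{g\in Q}\Bigl(\sum_{y\in W_n}\|f(g\bar y)-f(g)\|^2\,\mu_n(y)\Bigr)\le C\sum_{g\in Q,\ s\in S}\|f(g\bar s)-f(g)\|^2 .$$ -/

import Mathlib

open Filter Topology

universe u v w x

/-- `(G, Y)` has relative Property (T): for every orthogonal representation `π` of `G` on a real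
Hilbert space and every sequence of unit vectors that is almost invariant, i.e.
`‖π g vₙ - vₙ‖ → 0` for each `g ∈ G`, this convergence is uniform on `Y`.
(Hilbert spaces range over the universe of `G`; as `G` is countable in all uses and one may pass to
the closed invariant subspace generated by the `vₙ`, separable Hilbert spaces suffice.) -/
def HasRelativePropertyT (G : Type u) [Group G] (Y : Set G) : Prop :=
  ∀ (H : Type u) [NormedAddCommGroup H] [InnerProductSpace ℝ H] [CompleteSpace H]
    (π : G →* (H ≃ₗᵢ[ℝ] H)) (v : ℕ → H),
    (∀ n, ‖v n‖ = 1) →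
    (∀ g : G, Tendsto (fun n => ‖π g (v n) - v n‖) atTop (𝓝 0)) →
    TendstoUniformlyOn (fun n g => ‖π g (v n) - v n‖) (fun _ => 0) atTop Y

/-- The (discrete, countable) group `G` has the Haagerup property: it admits a metrically proper
affine isometric action `σ` on a real Hilbert space, i.e. the cocycle `b g = σ g 0` takes values
in any given ball for only finitely many `g`. As `‖b g - b h‖ = ‖b (g⁻¹ * h)‖`, this says that `b`
is a coarse embedding. -/
def HasHaagerupProperty (G : Type u) [Group G] : Prop :=
  ∃ (H : Type u) (_ : NormedAddCommGroup H) (_ : InnerProductSpace ℝ H) (_ : CompleteSpace H)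
    (σ : G →* (H ≃ᵃⁱ[ℝ] H)), ∀ R : ℝ, {g : G | ‖σ g 0‖ ≤ R}.Finite

/-- The word length of `g` with respect to `S`: the least length of a word in `S ∪ S⁻¹` that
represents `g`, that is, `d(e, g)` in the word metric. -/
noncomputable def wordLength {G : Type u} [Group G] (S : Set G) (g : G) : ℕ :=
  sInf {n : ℕ | ∃ l : List G, l.length = n ∧ (∀ a ∈ l, a ∈ S ∨ a⁻¹ ∈ S) ∧ l.prod = g}

/-!
Both inequalities are statements about conditionally negative definite functions on `G`. For a
function `f` on a finite quotient `Q` with values in a Hilbert space, the energy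
`ψ g = ∑ a, ‖f (a * q g) - f a‖ ^ 2` is the squared norm of a coboundary, hence conditionally
negative definite (`IsCondNegDef.sum_norm_sub_sq`). So it suffices to bound `ψ y`, respectively an
average of `ψ`, by a multiple of `∑ s ∈ S, ψ s`, uniformly over all such `ψ`. What makes uniformity
possible is that `∑ s ∈ S, ψ s` controls `ψ` pointwise, because `ψ (g * h) ≤ 2 ψ g + 2 ψ h`
(`IsCondNegDef.exists_le_mul_sum`).

Under relative Property (T), a sequence of functions violating every such bound is rescaled to be
`1` at points of `Y`; it then tends to `0` pointwise. The functions `exp (-ψ)` are positive definite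
by Schoenberg's theorem (`IsCondNegDef.posSemidef_exp_neg`), and the sum of their
Gelfand-Naimark-Segal representations contains almost invariant unit vectors that move by a definite
amount at points of `Y`, a contradiction (`HasRelativePropertyT.exists_le_mul_sum`).

Without the Haagerup property, consider the compact convex set of `ψ` with `∑ s ∈ S, ψ s ≤ 1`. By
the Hahn-Banach theorem, for each `C` and `n` either some `ψ` in this set is at least `C` outside
the ball of radius `n`, or a finitely supported probability measure outside that ball averages every
`ψ` in the set to at most `C` (`exists_forall_le_or_exists_pmf`). If for every `C` the first case
occurred for some `n`, a weighted sum of the resulting functions would be a proper conditionally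
negative definite function, and the affine action it defines would give the Haagerup property
(`hasHaagerupProperty_of_forall_exists`). So for some `C` the second case occurs for all `n`.
-/

open scoped Matrix

/-! ### Positive semidefinite kernels -/

namespace Matrix.PosSemidef

variable {X : Type*}

/-- Positive semidefiniteness passes to entrywise limits. -/
theorem of_tendsto {ι : Type*} {l : Filter ι} [l.NeBot] {M : ι → Matrix X X ℝ}
    {N : Matrix X X ℝ} (hM : ∀ i, (M i).PosSemidef)
    (h : ∀ x y, Tendsto (fun i => M i x y) l (𝓝 (N x y))) : N.PosSemidef := by
  refine ⟨?_, fun c => ?_⟩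
  · ext x y
    refine tendsto_nhds_unique (h y x) ((h x y).congr fun i => ?_)
    simpa using (hM i).isHermitian.apply y x
  · refine ge_of_tendsto (x := l) (f := fun i => c.sum fun x a => c.sum fun y b =>
      star a * M i x y * b) ?_ (Eventually.of_forall fun i => (hM i).2 c)
    exact tendsto_finsetSum _ fun x _ => tendsto_finsetSum _ fun y _ =>
      ((h x y).const_mul _).mul_const _

/-- Gram kernels are positive semidefinite, over an index type that may be infinite. -/
theorem gram_real {H : Type*} [NormedAddCommGroup H] [InnerProductSpace ℝ H] (Φ : X → H) :
    (Matrix.gram ℝ Φ).PosSemidef := by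
  refine ⟨isHermitian_gram ℝ Φ, fun c => ?_⟩
  have : (c.sum fun x s => c.sum fun y t => star s * Matrix.gram ℝ Φ x y * t) =
      inner ℝ (c.sum fun x s => s • Φ x) (c.sum fun x s => s • Φ x) := by
    simp only [Finsupp.sum, sum_inner, inner_sum, gram_apply, star_trivial, real_inner_smul_right,
      real_inner_comm]
    refine Finset.sum_congr rfl fun x _ => Finset.sum_congr rfl fun y _ => ?_
    ring
  rw [this]
  exact real_inner_self_nonneg

theorem rankOne (a : X → ℝ) : (of fun x y => a x * a y : Matrix X X ℝ).PosSemidef := by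
  have : (of fun x y => a x * a y : Matrix X X ℝ) = Matrix.gram ℝ a := by
    ext x y
    simp [mul_comm]
  rw [this]
  exact gram_real a

theorem map_pow {M : Matrix X X ℝ} (hM : M.PosSemidef) (n : ℕ) :
    (M.map (· ^ n)).PosSemidef := by
  induction n with
  | zero => simpa [Matrix.map, Matrix.of] using rankOne (fun _ : X => (1 : ℝ))
  | succ n ih =>
    have : M.map (· ^ (n + 1)) = M.map (· ^ n) ⊙ M := by
      ext x y
      simp [pow_succ]
    rw [this]
    exact ih.hadamard hM

/-- The entrywise exponential preserves positive semidefiniteness, by the Schur product theorem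
applied to the terms of the exponential series. -/
theorem map_exp {M : Matrix X X ℝ} (hM : M.PosSemidef) : (M.map Real.exp).PosSemidef := by
  refine of_tendsto (l := atTop)
    (M := fun n => ∑ k ∈ Finset.range n, ((k.factorial : ℝ)⁻¹) • M.map (· ^ k))
    (fun n => posSemidef_sum _ fun k _ => (hM.map_pow k).smul (by positivity)) fun x y => ?_
  have := (NormedSpace.expSeries_div_hasSum_exp (M x y)).tendsto_sum_nat
  rw [← Real.exp_eq_exp_ℝ] at this
  simpa [Matrix.sum_apply, div_eq_inv_mul] using this

/-- The block diagonal kernel formed from a sequence of positive semidefinite kernels. -/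
theorem blockDiag {M : ℕ → Matrix X X ℝ} (hM : ∀ n, (M n).PosSemidef) :
    (of fun p q => if p.1 = q.1 then M p.1 p.2 q.2 else 0 :
      Matrix (ℕ × X) (ℕ × X) ℝ).PosSemidef := by
  refine of_tendsto (l := atTop)
    (M := fun n => ∑ k ∈ Finset.range n,
      (of fun p q : ℕ × X => (if p.1 = k then (1 : ℝ) else 0) * (if q.1 = k then 1 else 0)) ⊙
        (M k).submatrix Prod.snd Prod.snd)
    (fun n => posSemidef_sum _ fun k _ =>
      (rankOne fun p : ℕ × X => if p.1 = k then (1 : ℝ) else 0).hadamard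
        ((hM k).submatrix Prod.snd)) fun p q => ?_
  refine tendsto_const_nhds.congr' ?_
  filter_upwards [eventually_gt_atTop p.1] with n hn
  simp only [of_apply, sum_apply, hadamard_apply, submatrix_apply]
  rw [Finset.sum_eq_single p.1]
  · simp [eq_comm]
  · intro k _ hk
    simp [hk.symm]
  · intro h
    exact absurd (Finset.mem_range.2 hn) h

/-- A positive semidefinite kernel on `X` is the Gram kernel of a family of vectors that spans a
dense subspace of a Hilbert space in the universe of `X`. -/
theorem exists_gram {X : Type u} {M : Matrix X X ℝ} (hM : M.PosSemidef) :
    ∃ (H : Type u) (_ : NormedAddCommGroup H) (_ : InnerProductSpace ℝ H) (_ : CompleteSpace H)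
      (Φ : X → H), (∀ x y, inner ℝ (Φ x) (Φ y) = M x y) ∧
        DenseRange (Finsupp.linearCombination ℝ Φ) := by
  -- scalars as operators on the one-dimensional space `ℝ`, as expected by `RKHS.OfKernel`
  let K : Matrix X X (ℝ →L[ℝ] ℝ) := of fun x y => M x y • 1
  have hKapp : ∀ x y v, K x y v = M x y * v := fun x y v => by simp [K]
  have hsymm : ∀ x y, M x y = M y x := fun x y => by simpa using hM.isHermitian.apply y x
  have hK : K.PosSemidef := by
    have key := (RKHS.posSemidef_tfae (K := K)).out 0 2
    refine key.mpr ⟨?_, fun c => ?_⟩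
    · ext x y
      simp [K, Matrix.conjTranspose_apply, hsymm y x]
    · have hsum : (c.sum fun x s => c.sum fun y t => inner ℝ (K y x s) t) =
          c.sum fun x s => c.sum fun y t => star s * M x y * t := by
        simp only [hKapp, Finsupp.sum]
        refine Finset.sum_congr rfl fun x _ => Finset.sum_congr rfl fun y _ => ?_
        simp [hsymm y x]
        ring
      rw [hsum]
      exact hM.2 c
  have : Fact K.PosSemidef := ⟨hK⟩
  refine ⟨RKHS.OfKernel K, inferInstance, inferInstance, inferInstance,
    fun x => RKHS.kerFun (RKHS.OfKernel K) x 1, fun x y => ?_, ?_⟩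
  · rw [← RKHS.kernel_inner, RKHS.OfKernel.kernel_ofKernel, hKapp]
    simp [hsymm x y]
  · have := RKHS.kerFun_dense (RKHS.OfKernel K)
    rw [← Submodule.dense_iff_topologicalClosure_eq_top] at this
    refine this.mono ?_
    rw [← LinearMap.coe_range, Finsupp.range_linearCombination]
    refine SetLike.coe_subset_coe.2 (Submodule.span_le.2 ?_)
    rintro _ ⟨x, a, rfl⟩
    have : RKHS.kerFun (RKHS.OfKernel K) x a = a • RKHS.kerFun (RKHS.OfKernel K) x 1 := by
      rw [← map_smul]; simp
    rw [this]
    exact Submodule.smul_mem _ _ (Submodule.subset_span ⟨x, rfl⟩)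

end Matrix.PosSemidef

/-! ### Extending isometric actions from a dense subspace -/

/-- Linear maps `ρ g` on `E` that, after composition with the dense map `e : E → H`, are
multiplicative in `g` and norm preserving extend to an orthogonal representation on `H`. -/
theorem exists_orthogonal_rep {G : Type*} [Group G] {E H : Type*} [AddCommGroup E] [Module ℝ E]
    [NormedAddCommGroup H] [InnerProductSpace ℝ H] [CompleteSpace H]
    (e : E →ₗ[ℝ] H) (he : DenseRange e) (ρ : G → E →ₗ[ℝ] E)
    (hone : ∀ c, e (ρ 1 c) = e c) (hmul : ∀ g h c, e (ρ (g * h) c) = e (ρ g (ρ h c)))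
    (hnorm : ∀ g c, ‖e (ρ g c)‖ = ‖e c‖) :
    ∃ π : G →* (H ≃ₗᵢ[ℝ] H), ∀ g c, π g (e c) = e (ρ g c) := by
  have hb : ∀ g, ∃ C, ∀ c, ‖(e ∘ₗ ρ g) c‖ ≤ C * ‖e c‖ := fun g =>
    ⟨1, fun c => by simp [hnorm]⟩
  let L : G → H →L[ℝ] H := fun g => (e ∘ₗ ρ g).extendOfNorm e
  have hL : ∀ g c, L g (e c) = e (ρ g c) := fun g c => LinearMap.extendOfNorm_eq he (hb g) c
  have hL1 : ∀ x, L 1 x = x := fun x =>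
    he.induction_on (p := fun x => L 1 x = x) x
      (isClosed_eq (L 1).continuous continuous_id) fun c => by rw [hL, hone]
  have hLmul : ∀ g h x, L (g * h) x = L g (L h x) := fun g h x =>
    he.induction_on (p := fun x => L (g * h) x = L g (L h x)) x
      (isClosed_eq (L _).continuous ((L g).continuous.comp (L h).continuous))
      fun c => by simp only [hL, hmul]
  have hLnorm : ∀ g x, ‖L g x‖ = ‖x‖ := fun g x =>
    he.induction_on (p := fun x => ‖L g x‖ = ‖x‖) x
      (isClosed_eq (L _).continuous.norm continuous_norm)
      fun c => by simp only [hL, hnorm]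
  let π : G → (H ≃ₗᵢ[ℝ] H) := fun g =>
    { toFun := L g
      invFun := L g⁻¹
      map_add' := map_add (L g)
      map_smul' := map_smul (L g)
      left_inv := fun x => by rw [← hLmul, inv_mul_cancel, hL1]
      right_inv := fun x => by rw [← hLmul, mul_inv_cancel, hL1]
      norm_map' := hLnorm g }
  exact ⟨{ toFun := π
           map_one' := LinearIsometryEquiv.ext hL1
           map_mul' := fun g h => LinearIsometryEquiv.ext (hLmul g h) }, hL⟩

/-! ### Conditionally negative definite functions -/

/-- A real function `ψ` on a group is conditionally negative definite. The condition is encoded,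
through Schoenberg's criterion, as `ψ 1 = 0` together with positive semidefiniteness of the kernel
`ψ g + ψ h - ψ (g⁻¹ * h)`, which is twice the Gram kernel of a
cocycle `b` with `‖b g‖² = ψ g`. Symmetry of the kernel contains `ψ g⁻¹ = ψ g`. -/
def IsCondNegDef {G : Type*} [Group G] (ψ : G → ℝ) : Prop :=
  ψ 1 = 0 ∧ (Matrix.of fun g h => ψ g + ψ h - ψ (g⁻¹ * h)).PosSemidef

namespace IsCondNegDef

variable {G : Type*} [Group G] {ψ φ : G → ℝ}

theorem map_inv (hψ : IsCondNegDef ψ) (g : G) : ψ g⁻¹ = ψ g := by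
  have := hψ.2.isHermitian.apply g 1
  simp at this
  linarith

theorem nonneg (hψ : IsCondNegDef ψ) (g : G) : 0 ≤ ψ g := by
  have := hψ.2.diag_nonneg (i := g)
  simp [hψ.1] at this
  linarith

theorem zero : IsCondNegDef (0 : G → ℝ) := by
  refine ⟨rfl, ?_⟩
  convert! Matrix.PosSemidef.zero (n := G) (R := ℝ) using 1
  ext g h
  simp

theorem add (hψ : IsCondNegDef ψ) (hφ : IsCondNegDef φ) : IsCondNegDef (ψ + φ) := by
  refine ⟨by simp [hψ.1, hφ.1], ?_⟩
  convert! hψ.2.add hφ.2 using 1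
  ext g h
  simp
  ring

theorem smul (hψ : IsCondNegDef ψ) {t : ℝ} (ht : 0 ≤ t) : IsCondNegDef (t • ψ) := by
  refine ⟨by simp [hψ.1], ?_⟩
  convert! hψ.2.smul ht using 1
  ext g h
  simp
  ring

theorem sum {ι : Type*} {s : Finset ι} {ψ : ι → G → ℝ} (hψ : ∀ i ∈ s, IsCondNegDef (ψ i)) :
    IsCondNegDef (∑ i ∈ s, ψ i) :=
  Finset.sum_induction _ IsCondNegDef (fun _ _ => add) zero hψ

theorem of_tendsto {ι : Type*} {l : Filter ι} [l.NeBot] {ψ : ι → G → ℝ} {φ : G → ℝ}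
    (hψ : ∀ i, IsCondNegDef (ψ i)) (h : ∀ g, Tendsto (fun i => ψ i g) l (𝓝 (φ g))) :
    IsCondNegDef φ :=
  ⟨tendsto_nhds_unique ((h 1).congr fun i => (hψ i).1) tendsto_const_nhds,
    .of_tendsto (fun i => (hψ i).2) fun g k => ((h g).add (h k)).sub (h (g⁻¹ * k))⟩

theorem isClosed_setOf : IsClosed {ψ : G → ℝ | IsCondNegDef ψ} := by
  refine isClosed_of_closure_subset fun φ hφ => ?_
  have : (comap (Subtype.val : {ψ : G → ℝ // IsCondNegDef ψ} → G → ℝ) (𝓝 φ)).NeBot :=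
    mem_closure_iff_comap_neBot.1 hφ
  exact of_tendsto (fun ψ : {ψ : G → ℝ // IsCondNegDef ψ} => ψ.2) fun g =>
    ((continuous_apply g).tendsto φ).comp tendsto_comap

/-- The values on `S` control `ψ` pointwise, uniformly over all conditionally negative definite
`ψ`. -/
theorem exists_le_mul_sum {S : Finset G} (hS : Subgroup.closure (S : Set G) = ⊤) (g : G) :
    ∃ M : ℝ, 0 ≤ M ∧ ∀ ψ : G → ℝ, IsCondNegDef ψ → ψ g ≤ M * ∑ s ∈ S, ψ s := by
  have hg : g ∈ Subgroup.closure (S : Set G) := hS ▸ Subgroup.mem_top g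
  induction hg using Subgroup.closure_induction with
  | mem s hs =>
    exact ⟨1, zero_le_one, fun ψ hψ => by
      simpa using Finset.single_le_sum (fun s _ => hψ.nonneg s) hs⟩
  | one => exact ⟨0, le_rfl, fun ψ hψ => by simp [hψ.1]⟩
  | mul g h _ _ ihg ihh =>
    obtain ⟨M, hM, hMψ⟩ := ihg
    obtain ⟨N, hN, hNψ⟩ := ihh
    refine ⟨2 * M + 2 * N, by positivity, fun ψ hψ => ?_⟩
    have h1 := hMψ ψ hψ
    have h2 := hNψ ψ hψ
    -- the parallelogram inequality `‖b g⁻¹ + b h‖² ≥ 0` for the associated cocycle `b`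
    obtain ⟨H, _, _, _, Φ, hΦ, -⟩ := hψ.2.exists_gram
    have h3 := sq_nonneg ‖Φ g⁻¹ + Φ h‖
    rw [norm_add_sq_real, ← real_inner_self_eq_norm_sq, ← real_inner_self_eq_norm_sq] at h3
    simp only [hΦ, Matrix.of_apply, inv_mul_cancel, mul_inv_cancel, hψ.1, hψ.map_inv,
      inv_inv] at h3
    linarith
  | inv g _ ih =>
    obtain ⟨M, hM, hMψ⟩ := ih
    exact ⟨M, hM, fun ψ hψ => by rw [hψ.map_inv]; exact hMψ ψ hψ⟩

/-- The Schoenberg correspondence: `exp (-ψ)` is a positive definite function. -/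
theorem posSemidef_exp_neg (hψ : IsCondNegDef ψ) :
    (Matrix.of fun g h => Real.exp (-ψ (g⁻¹ * h))).PosSemidef := by
  have : (Matrix.of fun g h => Real.exp (-ψ (g⁻¹ * h))) =
      (Matrix.of fun g h => Real.exp (-ψ g) * Real.exp (-ψ h)) ⊙
        (Matrix.of fun g h => ψ g + ψ h - ψ (g⁻¹ * h)).map Real.exp := by
    ext g h
    simp only [Matrix.of_apply, Matrix.hadamard_apply, Matrix.map_apply, ← Real.exp_add]
    ring_nf
  rw [this]
  exact (Matrix.PosSemidef.rankOne _).hadamard hψ.2.map_exp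

/-- The energy of a function on a group `Q`, displaced along a homomorphism `q : G →* Q`, is
conditionally negative definite: it is the squared norm of the coboundary of `f` in the space of
functions on `Q`. -/
theorem sum_norm_sub_sq {Q : Type*} [Group Q] [Fintype Q] (q : G →* Q) (𝕜 : Type*) [RCLike 𝕜]
    {H : Type*} [NormedAddCommGroup H] [InnerProductSpace 𝕜 H] (f : Q → H) :
    IsCondNegDef fun g => ∑ a : Q, ‖f (a * q g) - f a‖ ^ 2 := by
  let _ := InnerProductSpace.rclikeToReal 𝕜 H
  refine ⟨by simp, ?_⟩
  have : (Matrix.of fun g h => ∑ a : Q, ‖f (a * q g) - f a‖ ^ 2 +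
      ∑ a : Q, ‖f (a * q h) - f a‖ ^ 2 - ∑ a : Q, ‖f (a * q (g⁻¹ * h)) - f a‖ ^ 2) =
      ∑ a : Q, (2 : ℝ) • Matrix.gram ℝ fun g => f (a * q g) - f a := by
    ext g h
    -- translate the third sum by `q g`
    have hshift : ∑ a : Q, ‖f (a * q (g⁻¹ * h)) - f a‖ ^ 2 =
        ∑ a : Q, ‖f (a * q g) - f (a * q h)‖ ^ 2 := by
      rw [← Equiv.sum_comp (Equiv.mulRight (q g))]
      exact Finset.sum_congr rfl fun a _ => by simp [mul_assoc, norm_sub_rev]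
    rw [Matrix.of_apply, hshift, ← Finset.sum_add_distrib, ← Finset.sum_sub_distrib,
      Matrix.sum_apply]
    refine Finset.sum_congr rfl fun a _ => ?_
    have := norm_sub_sq_real (f (a * q g) - f a) (f (a * q h) - f a)
    rw [sub_sub_sub_cancel_right] at this
    simp only [Matrix.smul_apply, Matrix.gram_apply, smul_eq_mul]
    linarith
  rw [this]
  exact Matrix.posSemidef_sum _ fun a _ => (Matrix.PosSemidef.gram_real _).smul (by norm_num)

end IsCondNegDef

/-! ### Representations and affine actions from kernels -/

theorem norm_linearCombination_eq_of_inner_eq {X H : Type*} [NormedAddCommGroup H]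
    [InnerProductSpace ℝ H] {Φ Ψ : X → H}
    (h : ∀ x y, inner ℝ (Φ x) (Φ y) = inner ℝ (Ψ x) (Ψ y)) (c : X →₀ ℝ) :
    ‖Finsupp.linearCombination ℝ Φ c‖ = ‖Finsupp.linearCombination ℝ Ψ c‖ := by
  rw [← sq_eq_sq₀ (norm_nonneg _) (norm_nonneg _), ← real_inner_self_eq_norm_sq,
    ← real_inner_self_eq_norm_sq]
  simp only [Finsupp.linearCombination_apply, Finsupp.sum, sum_inner, inner_sum, inner_smul_left,
    inner_smul_right, h]

/-- The Gelfand-Naimark-Segal construction for a kernel that is invariant under a group action. -/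
theorem Matrix.PosSemidef.exists_orthogonal_rep {G : Type*} [Group G] {X : Type u} [MulAction G X]
    {M : Matrix X X ℝ} (hM : M.PosSemidef) (hinv : ∀ (g : G) x y, M (g • x) (g • y) = M x y) :
    ∃ (H : Type u) (_ : NormedAddCommGroup H) (_ : InnerProductSpace ℝ H) (_ : CompleteSpace H)
      (π : G →* (H ≃ₗᵢ[ℝ] H)) (Φ : X → H), (∀ x y, inner ℝ (Φ x) (Φ y) = M x y) ∧
        ∀ g x, π g (Φ x) = Φ (g • x) := by
  obtain ⟨H, _, _, _, Φ, hΦ, hdense⟩ := hM.exists_gram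
  have hρ : ∀ (g : G) c, Finsupp.linearCombination ℝ Φ (Finsupp.lmapDomain ℝ ℝ (g • ·) c) =
      Finsupp.linearCombination ℝ (fun x => Φ (g • x)) c := fun g c => by
    simp [Finsupp.linearCombination_mapDomain, Function.comp_def]
  obtain ⟨π, hπ⟩ := _root_.exists_orthogonal_rep (Finsupp.linearCombination ℝ Φ) hdense
    (fun g : G => Finsupp.lmapDomain ℝ ℝ (g • ·)) (fun c => by simp [Function.comp_def])
    (fun g h c => by
      simp only [Finsupp.lmapDomain_apply, ← Finsupp.mapDomain_comp, Function.comp_def, mul_smul])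
    (fun g c => by
      rw [hρ]
      exact norm_linearCombination_eq_of_inner_eq (fun x y => by rw [hΦ, hΦ, hinv]) c)
  refine ⟨H, _, _, ‹_›, π, Φ, hΦ, fun g x => ?_⟩
  simpa using hπ g (Finsupp.single x 1)

/-- A conditionally negative definite function is, up to a factor `2`, the squared displacement of
the origin under an affine isometric action. -/
theorem IsCondNegDef.exists_affine_action {G : Type u} [Group G] {ψ : G → ℝ}
    (hψ : IsCondNegDef ψ) :
    ∃ (H : Type u) (_ : NormedAddCommGroup H) (_ : InnerProductSpace ℝ H) (_ : CompleteSpace H)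
      (σ : G →* (H ≃ᵃⁱ[ℝ] H)), ∀ g, ‖σ g 0‖ ^ 2 = 2 * ψ g := by
  obtain ⟨H, _, _, _, Φ, hΦ, hdense⟩ := hψ.2.exists_gram
  have hΦsq : ∀ g, ‖Φ g‖ ^ 2 = 2 * ψ g := fun g => by
    rw [← real_inner_self_eq_norm_sq, hΦ]
    simp [hψ.1]
    ring
  have hΦ1 : Φ 1 = 0 := by
    have := hΦsq 1
    rw [hψ.1] at this
    simpa using this
  -- the linear part sends `Φ h` to `Φ (g * h) - Φ g`, as the cocycle identity requires
  let ρ : G → (G →₀ ℝ) →ₗ[ℝ] (G →₀ ℝ) := fun g =>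
    Finsupp.linearCombination ℝ fun h => Finsupp.single (g * h) 1 - Finsupp.single g 1
  have hρ : ∀ g c, Finsupp.linearCombination ℝ Φ (ρ g c) =
      Finsupp.linearCombination ℝ (fun h => Φ (g * h) - Φ g) c := fun g c => by
    refine LinearMap.congr_fun (f := Finsupp.linearCombination ℝ Φ ∘ₗ ρ g) ?_ c
    ext h
    simp [ρ]
  obtain ⟨π, hπ⟩ := exists_orthogonal_rep (Finsupp.linearCombination ℝ Φ) hdense ρ
    (fun c => by rw [hρ]; simp [hΦ1])
    (fun g h c => by
      refine LinearMap.congr_fun (f := Finsupp.linearCombination ℝ Φ ∘ₗ ρ (g * h))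
        (g := Finsupp.linearCombination ℝ Φ ∘ₗ ρ g ∘ₗ ρ h) ?_ c
      ext k
      simp [ρ, mul_assoc])
    (fun g c => by
      rw [hρ]
      refine norm_linearCombination_eq_of_inner_eq (fun x y => ?_) c
      have h1 : (g * x)⁻¹ * (g * y) = x⁻¹ * y := by group
      have h2 : (g * x)⁻¹ * g = x⁻¹ := by group
      have h3 : g⁻¹ * (g * y) = y := by group
      simp only [inner_sub_left, inner_sub_right, hΦ, Matrix.of_apply, h1, h2, h3,
        inv_mul_cancel, hψ.1, hψ.map_inv]
      ring)
  have hcocycle : ∀ g h, Φ (g * h) = π g (Φ h) + Φ g := fun g h => by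
    have := hπ g (Finsupp.single h 1)
    simp only [hρ, Finsupp.linearCombination_single, one_smul] at this
    rw [this, sub_add_cancel]
  let σ : G → (H ≃ᵃⁱ[ℝ] H) := fun g =>
    (π g).toAffineIsometryEquiv.trans (AffineIsometryEquiv.constVAdd ℝ H (Φ g))
  have hσ : ∀ g x, σ g x = Φ g + π g x := fun g x => by simp [σ]
  refine ⟨H, _, _, ‹_›, { toFun := σ, map_one' := ?_, map_mul' := fun g h => ?_ }, fun g => ?_⟩
  · ext x
    rw [hσ]
    simp [hΦ1]
  · ext x
    rw [AffineIsometryEquiv.coe_mul, Function.comp_apply, hσ, hσ, hσ, hcocycle, map_add, map_mul,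
      LinearIsometryEquiv.coe_mul, Function.comp_apply]
    abel
  · change ‖σ g 0‖ ^ 2 = _
    rw [hσ, map_zero, add_zero, hΦsq]

/-! ### Relative Property (T) bounds conditionally negative definite functions -/

/-- Relative Property (T) implies a quantitative relative fixed point property: on `Y`, a
conditionally negative definite function is at most a constant multiple of its sum over a
generating set. A sequence of counterexamples, rescaled to take the value `1` somewhere on `Y`,
tends to zero pointwise; exponentiating turns it into almost invariant vectors that are not
uniformly almost invariant on `Y`. -/
theorem HasRelativePropertyT.exists_le_mul_sum {G : Type u} [Group G] {S : Finset G}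
    (hS : Subgroup.closure (S : Set G) = ⊤) {Y : Set G} (hY : HasRelativePropertyT G Y) :
    ∃ C : ℝ, 0 < C ∧ ∀ ψ : G → ℝ, IsCondNegDef ψ → ∀ y ∈ Y, ψ y ≤ C * ∑ s ∈ S, ψ s := by
  by_contra! hcon
  choose ψ hψ y hyY hy using fun n : ℕ => hcon (n + 1) n.cast_add_one_pos
  have hE : ∀ n, 0 ≤ ∑ s ∈ S, ψ n s := fun n => Finset.sum_nonneg fun s _ => (hψ n).nonneg s
  have hpos : ∀ n, 0 < ψ n (y n) := fun n =>
    (mul_nonneg n.cast_add_one_pos.le (hE n)).trans_lt (hy n)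
  let φ : ℕ → G → ℝ := fun n => (ψ n (y n))⁻¹ • ψ n
  have hφ : ∀ n, IsCondNegDef (φ n) := fun n => (hψ n).smul (inv_nonneg.2 (hpos n).le)
  have hφy : ∀ n, φ n (y n) = 1 := fun n => inv_mul_cancel₀ (hpos n).ne'
  have hφS : ∀ n : ℕ, ∑ s ∈ S, φ n s ≤ 1 / (n + 1) := fun n => by
    have h1 : ∑ s ∈ S, φ n s = (∑ s ∈ S, ψ n s) / ψ n (y n) := by
      rw [div_eq_inv_mul, Finset.mul_sum]
      rfl
    rw [h1, div_le_div_iff₀ (hpos n) n.cast_add_one_pos, one_mul, mul_comm]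
    exact (hy n).le
  have hφlim : ∀ g, Tendsto (fun n => φ n g) atTop (𝓝 0) := fun g => by
    obtain ⟨M, hM, hMφ⟩ := IsCondNegDef.exists_le_mul_sum hS g
    refine squeeze_zero (fun n => (hφ n).nonneg g)
      (fun n => (hMφ _ (hφ n)).trans (mul_le_mul_of_nonneg_left (hφS n) hM)) ?_
    simpa using tendsto_one_div_add_atTop_nhds_zero_nat.const_mul M
  -- the orthogonal sum of the representations given by `exp (-φ n)`
  let _ : MulAction G (ℕ × G) :=
    { smul := fun g p => (p.1, g * p.2)
      one_smul := fun p => by ext <;> simp [HSMul.hSMul]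
      mul_smul := fun g h p => by ext <;> simp [HSMul.hSMul, mul_assoc] }
  have hsmul : ∀ (g : G) (p : ℕ × G), g • p = (p.1, g * p.2) := fun _ _ => rfl
  obtain ⟨H, _, _, _, π, Φ, hΦ, hπ⟩ := Matrix.PosSemidef.exists_orthogonal_rep (G := G)
    (Matrix.PosSemidef.blockDiag fun n => (hφ n).posSemidef_exp_neg)
    (fun g p q => by simp [hsmul, mul_assoc])
  have hunit : ∀ n g, ‖Φ (n, g)‖ = 1 := fun n g => by
    rw [← sq_eq_sq₀ (norm_nonneg _) zero_le_one, ← real_inner_self_eq_norm_sq, hΦ]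
    simp [(hφ n).1]
  have hdisp : ∀ n g, ‖π g (Φ (n, 1)) - Φ (n, 1)‖ ^ 2 = 2 - 2 * Real.exp (-φ n g) := fun n g => by
    rw [hπ, hsmul, norm_sub_sq_real, hunit, hunit, hΦ]
    simp [(hφ n).map_inv]
    ring
  have hunif := hY H π (fun n => Φ (n, 1)) (fun n => hunit n 1) fun g => by
    have h1 : Tendsto (fun n => 2 - 2 * Real.exp (-φ n g)) atTop (𝓝 0) := by
      have := ((Real.continuous_exp.tendsto _).comp (hφlim g).neg).const_mul 2 |>.const_sub 2
      simpa using this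
    have h2 := (h1.congr fun n => (hdisp n g).symm).sqrt
    simpa using h2
  obtain ⟨n, hn⟩ := (Metric.tendstoUniformlyOn_iff.1 hunif 1 one_pos).exists
  have h1 := hn (y n) (hyY n)
  rw [dist_zero_left, norm_norm] at h1
  have h2 := hdisp n (y n)
  rw [hφy] at h2
  have h3 : Real.exp (-1) < 1 / 2 := by
    rw [Real.exp_neg, inv_lt_comm₀ (Real.exp_pos _) (by norm_num)]
    linarith [Real.exp_one_gt_d9]
  nlinarith [norm_nonneg (π (y n) (Φ (n, 1)) - Φ (n, 1))]

/-! ### A minimax alternative -/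

/-- For a set `A` in the group, either some normalized conditionally negative definite function is
at least `C` on all of `A`, or some finitely supported probability measure on `A` averages every
conditionally negative definite function to at most `C` times its sum over `S`. By compactness,
failure of the first alternative is seen on a finite subset of `A`, and a normalized separating
functional is the required measure. -/
theorem exists_forall_le_or_exists_pmf {G : Type*} [Group G] {S : Finset G}
    (hS : Subgroup.closure (S : Set G) = ⊤) (A : Set G) {C : ℝ} (hC : 0 < C) :
    (∃ ψ : G → ℝ, IsCondNegDef ψ ∧ ∑ s ∈ S, ψ s ≤ 1 ∧ ∀ y ∈ A, C ≤ ψ y) ∨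
    ∃ (μ : PMF G) (W : Finset G), μ.support = W ∧ (W : Set G) ⊆ A ∧
      ∀ ψ : G → ℝ, IsCondNegDef ψ → ∑ y ∈ W, ψ y * (μ y).toReal ≤ C * ∑ s ∈ S, ψ s := by
  classical
  refine or_iff_not_imp_left.2 fun hno => ?_
  let 𝒦 : Set (G → ℝ) := {ψ | IsCondNegDef ψ ∧ ∑ s ∈ S, ψ s ≤ 1}
  have h𝒦conv : Convex ℝ 𝒦 := fun ψ hψ φ hφ a b ha hb hab => by
    refine ⟨(hψ.1.smul ha).add (hφ.1.smul hb), ?_⟩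
    simp only [Pi.add_apply, Pi.smul_apply, smul_eq_mul, Finset.sum_add_distrib, ← Finset.mul_sum]
    nlinarith [hψ.2, hφ.2]
  have h𝒦comp : IsCompact 𝒦 := by
    choose M hM hMψ using IsCondNegDef.exists_le_mul_sum hS
    refine (isCompact_univ_pi fun g => isCompact_Icc (a := (0 : ℝ)) (b := M g)).of_isClosed_subset
      ?_ fun ψ hψ g _ => ⟨hψ.1.nonneg g, (hMψ g ψ hψ.1).trans
        (mul_le_of_le_one_right (hM g) hψ.2)⟩
    exact IsCondNegDef.isClosed_setOf.inter (isClosed_le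
      (continuous_finsetSum S fun s _ => continuous_apply s) continuous_const)
  -- by compactness, finitely many points of `A` suffice
  obtain ⟨F, hFA, hF⟩ : ∃ F : Finset G, (F : Set G) ⊆ A ∧
      ∀ ψ ∈ 𝒦, ¬ ∀ y ∈ F, C ≤ ψ y := by
    obtain ⟨F, hF⟩ := h𝒦comp.elim_finite_subfamily_closed
      (fun y : A => {ψ : G → ℝ | C ≤ ψ y})
      (fun y => isClosed_le continuous_const (continuous_apply _)) (by
        refine Set.eq_empty_iff_forall_notMem.2 fun ψ ⟨hψ, hψA⟩ => hno ⟨ψ, hψ.1, hψ.2, ?_⟩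
        intro y hy
        exact Set.mem_iInter.1 hψA ⟨y, hy⟩)
    refine ⟨F.map (Function.Embedding.subtype _), by simp, fun ψ hψ hψF => ?_⟩
    refine Set.eq_empty_iff_forall_notMem.1 hF ψ ⟨hψ, Set.mem_iInter₂.2 fun y hy => ?_⟩
    exact hψF y (Finset.mem_map_of_mem _ hy)
  obtain ⟨f, a, b, hfa, hab, hfb⟩ := geometric_hahn_banach_compact_closed h𝒦conv h𝒦comp
    (t := {v : G → ℝ | ∀ y ∈ F, C ≤ v y})
    (fun v hv w hw a b ha hb hab y hy => by
      simp only [Pi.add_apply, Pi.smul_apply, smul_eq_mul]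
      nlinarith [mul_le_mul_of_nonneg_left (hv y hy) ha, mul_le_mul_of_nonneg_left (hw y hy) hb])
    (by
      simp only [Set.ofPred_forall]
      exact isClosed_biInter fun y _ => isClosed_le continuous_const (continuous_apply y))
    (Set.disjoint_left.2 hF)
  have ha : 0 < a := by simpa using hfa 0 ⟨IsCondNegDef.zero, by simp⟩
  -- the separating functional is nonnegative on functions that are nonnegative on `F`, since it
  -- is bounded below along rays in their direction
  have hf_nonneg : ∀ v : G → ℝ, (∀ y ∈ F, 0 ≤ v y) → 0 ≤ f v := fun v hv => by
    by_contra! hneg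
    obtain ⟨n, hn⟩ := exists_nat_gt (f (fun _ => C) / -f v)
    have h1 := hfb ((fun _ => C) + (n : ℝ) • v) fun y hy =>
      le_add_of_nonneg_right (mul_nonneg n.cast_nonneg (hv y hy))
    rw [map_add, map_smul, smul_eq_mul] at h1
    rw [div_lt_iff₀ (by linarith)] at hn
    linarith
  let c : G → ℝ := fun y => f (Pi.single y 1)
  have hc : ∀ y, 0 ≤ c y := fun y => hf_nonneg _ fun z _ => by
    rw [Pi.single_apply]
    split_ifs <;> norm_num
  have hf : ∀ v : G → ℝ, f v = ∑ y ∈ F, v y * c y := fun v => by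
    have hF0 : ∀ y ∈ F, (v - ∑ z ∈ F, v z • Pi.single z (1 : ℝ)) y = 0 := fun y hy => by
      simp [Finset.sum_apply, Pi.single_apply, hy]
    have h1 := hf_nonneg _ fun y hy => (hF0 y hy).ge
    have h2 := hf_nonneg (-(v - ∑ z ∈ F, v z • Pi.single z (1 : ℝ))) fun y hy => by
      rw [Pi.neg_apply, hF0 y hy, neg_zero]
    rw [map_neg] at h2
    have h3 : f (v - ∑ z ∈ F, v z • Pi.single z (1 : ℝ)) = 0 := by linarith
    simpa [map_sub, map_sum, map_smul, sub_eq_zero] using h3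
  have hb : b < C * ∑ y ∈ F, c y := by
    simpa [hf, Finset.mul_sum] using hfb (fun _ => C) fun _ _ => le_rfl
  have hcpos : 0 < ∑ y ∈ F, c y := by
    by_contra! hle
    have := mul_nonpos_of_nonneg_of_nonpos hC.le hle
    linarith
  let p : G → ℝ := fun y => if y ∈ F then c y / ∑ z ∈ F, c z else 0
  have hp : ∀ y, 0 ≤ p y := fun y => by
    simp only [p]
    split_ifs
    exacts [div_nonneg (hc y) hcpos.le, le_rfl]
  have hpsum : ∑ y ∈ F, p y = 1 := by
    rw [Finset.sum_congr rfl fun y hy => if_pos hy, ← Finset.sum_div, div_self hcpos.ne']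
  let μ : PMF G := PMF.ofFinset (fun y => ENNReal.ofReal (p y)) F
    (by rw [← ENNReal.ofReal_sum_of_nonneg fun y _ => hp y, hpsum, ENNReal.ofReal_one])
    (fun y hy => by simp [p, hy])
  have hμ : ∀ y, (μ y).toReal = p y := fun y => ENNReal.toReal_ofReal (hp y)
  have hμF : μ.support ⊆ F := fun y hy => ((PMF.mem_support_ofFinset_iff _ _ y).1 hy).1
  refine ⟨μ, {y ∈ F | y ∈ μ.support}, ?_, fun y hy => hFA (Finset.filter_subset _ _ hy),
    fun ψ hψ => ?_⟩
  · ext y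
    simpa using fun h => hμF ((μ.mem_support_iff y).2 h)
  have hrestrict : ∑ y ∈ F with y ∈ μ.support, ψ y * (μ y).toReal = ∑ y ∈ F, ψ y * (μ y).toReal :=
    Finset.sum_filter_of_ne fun y _ hy => by
      refine (μ.mem_support_iff y).2 fun h => hy ?_
      simp [h]
  have haverage : ∑ y ∈ F, ψ y * (μ y).toReal = f ψ / ∑ y ∈ F, c y := by
    rw [hf, Finset.sum_div]
    refine Finset.sum_congr rfl fun y hy => ?_
    rw [hμ, mul_div_assoc]
    simp [p, hy]
  rw [hrestrict, haverage, div_le_iff₀ hcpos]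
  have hE : 0 ≤ ∑ s ∈ S, ψ s := Finset.sum_nonneg fun s _ => hψ.nonneg s
  obtain hE | hE := hE.eq_or_lt
  -- a function of zero energy is zero
  · have hψ0 : ψ = 0 := funext fun g => by
      obtain ⟨M, -, hM⟩ := IsCondNegDef.exists_le_mul_sum hS g
      refine le_antisymm ?_ (hψ.nonneg g)
      simpa [← hE] using hM ψ hψ
    simp [hψ0]
  · have := hfa ((∑ s ∈ S, ψ s)⁻¹ • ψ) ⟨hψ.smul (inv_nonneg.2 hE.le), by
      simp only [Pi.smul_apply, smul_eq_mul, ← Finset.mul_sum]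
      rw [inv_mul_cancel₀ hE.ne']⟩
    rw [map_smul, smul_eq_mul, inv_mul_lt_iff₀ hE] at this
    nlinarith

/-! ### Groups without the Haagerup property -/

theorem wordLength_lt_finite {G : Type u} [Group G] {S : Finset G}
    (hS : Subgroup.closure (S : Set G) = ⊤) (n : ℕ) :
    {g : G | wordLength (S : Set G) g < n}.Finite := by
  let T : Set G := {a | a ∈ (S : Set G) ∨ a⁻¹ ∈ (S : Set G)}
  have hT : T.Finite := S.finite_toSet.union (S.finite_toSet.preimage inv_injective.injOn)
  have := hT.to_subtype
  refine ((List.finite_length_lt T n).image fun l => (l.map Subtype.val).prod).subset fun g hg => ?_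
  have hne : {n : ℕ | ∃ l : List G, l.length = n ∧
      (∀ a ∈ l, a ∈ (S : Set G) ∨ a⁻¹ ∈ (S : Set G)) ∧ l.prod = g}.Nonempty := by
    have hg : g ∈ (Subgroup.closure (S : Set G)).toSubmonoid := hS ▸ Subgroup.mem_top g
    rw [Subgroup.closure_toSubmonoid] at hg
    obtain ⟨l, hl, hlg⟩ := Submonoid.exists_list_of_mem_closure hg
    exact ⟨l.length, l, rfl, hl, hlg⟩
  obtain ⟨l, hl, hlS, hlg⟩ := Nat.sInf_mem hne
  lift l to List T using hlS
  refine ⟨l, ?_, hlg⟩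
  rw [List.length_map] at hl
  exact (hl.trans_lt hg :)

/-- Conditionally negative definite functions that are normalized on the generators and large
outside balls can be summed to a proper one. -/
theorem hasHaagerupProperty_of_forall_exists {G : Type u} [Group G] {S : Finset G}
    (hS : Subgroup.closure (S : Set G) = ⊤)
    (h : ∀ C : ℝ, 0 < C → ∃ (n : ℕ) (ψ : G → ℝ), IsCondNegDef ψ ∧ ∑ s ∈ S, ψ s ≤ 1 ∧
      ∀ y, n ≤ wordLength (S : Set G) y → C ≤ ψ y) : HasHaagerupProperty G := by
  choose N ψ hψ hψS hψN using fun k : ℕ => h (4 ^ k) (by positivity)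
  have hsum : ∀ g, Summable fun k => (1 / 2 : ℝ) ^ k * ψ k g := fun g => by
    obtain ⟨M, hM, hMψ⟩ := IsCondNegDef.exists_le_mul_sum hS g
    refine Summable.of_nonneg_of_le (fun k => mul_nonneg (by positivity) ((hψ k).nonneg g))
      (fun k => mul_le_mul_of_nonneg_left ((hMψ _ (hψ k)).trans
        (mul_le_of_le_one_right hM (hψS k))) (by positivity))
      (summable_geometric_two.mul_right M)
  let Ψ : G → ℝ := fun g => ∑' k, (1 / 2 : ℝ) ^ k * ψ k g
  have hΨ : IsCondNegDef Ψ := by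
    refine .of_tendsto (l := atTop)
      (ψ := fun n => ∑ k ∈ Finset.range n, (1 / 2 : ℝ) ^ k • ψ k)
      (fun n => .sum fun k _ => (hψ k).smul (by positivity)) fun g => ?_
    exact (hsum g).hasSum.tendsto_sum_nat.congr fun n => by simp
  obtain ⟨H, _, _, _, σ, hσ⟩ := hΨ.exists_affine_action
  refine ⟨H, _, _, ‹_›, σ, fun R => ?_⟩
  obtain ⟨k, hk⟩ := pow_unbounded_of_one_lt (R ^ 2) (one_lt_two (α := ℝ))
  refine (wordLength_lt_finite hS (N k)).subset fun g hg => ?_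
  by_contra hlt
  have h1 : (2 : ℝ) ^ k ≤ Ψ g := by
    refine le_trans ?_ ((hsum g).le_tsum k fun j _ =>
      mul_nonneg (by positivity) ((hψ j).nonneg g))
    have := mul_le_mul_of_nonneg_left (hψN k g (not_lt.1 hlt))
      (by positivity : (0 : ℝ) ≤ (1 / 2) ^ k)
    rw [← mul_pow] at this
    norm_num at this ⊢
    exact this
  have h2 : ‖σ g 0‖ ^ 2 ≤ R ^ 2 := pow_le_pow_left₀ (norm_nonneg _) hg 2
  rw [hσ] at h2
  have h3 : (0 : ℝ) < 2 ^ k := by positivity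
  linarith

/-! ### Inequalities on finite quotients -/

theorem mainTheorem4 (G : Type u) [Group G] (S : Finset G)
    (hS : Subgroup.closure (S : Set G) = ⊤) :
    (∀ Y : Set G, Y.Infinite → HasRelativePropertyT G Y →
      ∃ C : ℝ, 0 < C ∧
        ∀ (Q : Type v) [Group Q] [Fintype Q] (q : G →* Q), Function.Surjective q →
        ∀ (𝕜 : Type x) [RCLike 𝕜] (H : Type w) [NormedAddCommGroup H] [InnerProductSpace 𝕜 H]
          [CompleteSpace H] (f : Q → H), ∀ y ∈ Y,
          ∑ g : Q, ‖f (g * q y) - f g‖ ^ 2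
            ≤ C * ∑ g : Q, ∑ s ∈ S, ‖f (g * q s) - f g‖ ^ 2) ∧
    (¬ HasHaagerupProperty G →
      ∃ (C : ℝ) (μ : ℕ → PMF G) (W : ℕ → Finset G), 0 < C ∧
        (∀ n, (μ n).support = (W n : Set G)) ∧
        (∀ R : ℕ, ∀ᶠ n in atTop, ∀ y ∈ W n, R ≤ wordLength (S : Set G) y) ∧
        ∀ n : ℕ,
        ∀ (Q : Type v) [Group Q] [Fintype Q] (q : G →* Q), Function.Surjective q →
        ∀ (𝕜 : Type x) [RCLike 𝕜] (H : Type w) [NormedAddCommGroup H] [InnerProductSpace 𝕜 H]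
          [CompleteSpace H] (f : Q → H),
          ∑ g : Q, ∑ y ∈ W n, ‖f (g * q y) - f g‖ ^ 2 * (μ n y).toReal
            ≤ C * ∑ g : Q, ∑ s ∈ S, ‖f (g * q s) - f g‖ ^ 2) := by
  refine ⟨fun Y _ hY => ?_, fun hG => ?_⟩
  · obtain ⟨C, hC, hCψ⟩ := hY.exists_le_mul_sum hS
    refine ⟨C, hC, fun Q _ _ q _ 𝕜 _ H _ _ _ f y hy => ?_⟩
    rw [Finset.sum_comm]
    exact hCψ _ (IsCondNegDef.sum_norm_sub_sq q 𝕜 f) y hy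
  · obtain ⟨C, hC, hCn⟩ : ∃ C : ℝ, 0 < C ∧ ∀ (n : ℕ) (ψ : G → ℝ), IsCondNegDef ψ →
        ∑ s ∈ S, ψ s ≤ 1 → ∃ y, n ≤ wordLength (S : Set G) y ∧ ψ y < C := by
      by_contra! hcon
      exact hG (hasHaagerupProperty_of_forall_exists hS hcon)
    have hμ := fun n : ℕ => (exists_forall_le_or_exists_pmf hS
      {y | n ≤ wordLength (S : Set G) y} hC).resolve_left fun ⟨ψ, hψ, hψS, hψC⟩ =>
        let ⟨y, hy, hyC⟩ := hCn n ψ hψ hψS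
        (hψC y hy).not_gt hyC
    choose μ W hμW hW hμψ using hμ
    refine ⟨C, μ, W, hC, hμW, fun R => ?_, fun n Q _ _ q _ 𝕜 _ H _ _ _ f => ?_⟩
    · filter_upwards [eventually_ge_atTop R] with n hn y hy
      exact hn.trans (hW n hy)
    · rw [Finset.sum_comm, Finset.sum_comm (s := Finset.univ) (t := S)]
      simp only [← Finset.sum_mul]
      exact hμψ n _ (IsCondNegDef.sum_norm_sub_sq q 𝕜 f)
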